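/- A \emph{$\Delta$-complex} $X$ consists of sets $X_n$ ($n\ge 0$) of \emph{$n$-simplices}, maps $V$ assigning to each $\sigma\in X_n$ a set $V(\sigma)\subseteq X_0$ of exactly $n+1$ vertices, with $V(v)=\{v\}$ for $v\in X_0$, and, for every $n\ge 1$, $\sigma\in X_n$ and $v\in V(\sigma)$, a face $d_v\sigma\in X_{n-1}$, such that $V(d_v\sigma)=V(\sigma)\setminus\{v\}$, and $d_wd_v\sigma=d_vd_w\sigma$ for distinct $v,w\in V(\sigma)$ if $n\ge 2$. It is \emph{finite} if it has finitely many simplices in total. The \emph{face poset} $\chi(X)$ is the set of all simplices of $X$ with the partial order $\preceq$ generated by the relations $d_v\sigma\preceq\sigma$. A vertex $v$ of $X$ is \emph{dominated} if there is a vertex $v'\neq v$ such that for every simplex $\sigma$ with $v\preceq\sigma$ there exists a unique simplex $\tau$ with $V(\tau)=V(\sigma)\cup\{v'\}$ and $\sigma\preceq\tau$. Write $X\setminus v$ for the $\Delta$-complex obtained from $X$ by deleting all simplices $\sigma$ with $v\preceq\sigma$. The $\Delta$-complex $X$ is \emph{strongly collapsible} if there is a finite (possibly empty) sequence of steps, each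 replacing the current $\Delta$-complex $Z$ by $Z\setminus v$ for some dominated vertex $v$ of $Z$, that starts in $X$ and ends in a $\Delta$-complex consisting of a single vertex. An element $x$ of a finite poset $P$ is a \emph{beat point} if $\{y\in P: y<x\}$ has a greatest element or $\{y\in P: y>x\}$ has a least element. The poset $P$ is \emph{strongly collapsible} if there is a finite (possibly empty) sequence of steps, each removing a beat point of the current subposet (with the induced order), that starts in $P$ and ends in a one-point poset. \textbf{Theorem.} A finite $\Delta$-complex $X$ is strongly collapsible if and only if its face poset $\chi(X)$ is strongly collapsible. -/

import Mathlib

universe u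

/-- A `Δ`-complex (unordered): sets `S n` of `n`-simplices, the set `V σ` of the `n + 1` vertices of
an `n`-simplex `σ`, and for each vertex `v` of a simplex of positive dimension its face `d v σ`
opposite to `v`. A vertex has itself as its only vertex. -/
structure DeltaComplex where
  /-- the set of `n`-simplices; `S 0` is the set of vertices -/
  S : ℕ → Type u
  /-- the set of vertices of a simplex -/
  V : ∀ {n : ℕ}, S n → Finset (S 0)
  /-- the face of `σ` opposite to its vertex `v` -/
  d : ∀ {n : ℕ} (v : S 0) (σ : S (n + 1)), v ∈ V σ → S n
  card_V : ∀ {n : ℕ} (σ : S n), (V σ).card = n + 1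
  V_vertex : ∀ v : S 0, V v = {v}
  V_d : ∀ {n : ℕ} (v : S 0) (σ : S (n + 1)) (h : v ∈ V σ),
    (V (d v σ h) : Set (S 0)) = (V σ : Set (S 0)) \ {v}
  d_comm : ∀ {n : ℕ} (v w : S 0) (σ : S (n + 2)) (hv : v ∈ V σ) (hw : w ∈ V σ)
    (hwv : w ∈ V (d v σ hv)) (hvw : v ∈ V (d w σ hw)),
    d w (d v σ hv) hwv = d v (d w σ hw) hvw

namespace DeltaComplex

/-- The set `χ(X)` of all simplices of `X`. -/
def FacePoset (X : DeltaComplex.{u}) : Type u := Σ n : ℕ, X.S n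

namespace FacePoset

variable {X : DeltaComplex.{u}}

/-- The dimension of a simplex. -/
def dim (σ : X.FacePoset) : ℕ := σ.1

/-- The set of vertices of a simplex. -/
def verts (σ : X.FacePoset) : Finset (X.S 0) := X.V σ.2

/-- A vertex, as an element of `χ(X)`. -/
def ofVertex (v : X.S 0) : X.FacePoset := ⟨0, v⟩

/-- The face relation of codimension one: `σ = d v τ` for some vertex `v` of `τ`. -/
inductive FaceStep : X.FacePoset → X.FacePoset → Prop
  | mk {n : ℕ} (τ : X.S (n + 1)) (v : X.S 0) (h : v ∈ X.V τ) :
      FaceStep ⟨n, X.d v τ h⟩ ⟨n + 1, τ⟩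

theorem dim_le_or_eq {σ τ : X.FacePoset} (h : Relation.ReflTransGen FaceStep σ τ) :
    σ = τ ∨ σ.dim < τ.dim := by
  induction h with
  | refl => exact Or.inl rfl
  | tail _ hs ih =>
    right
    cases hs with
    | mk τ v h =>
      rcases ih with ih | ih
      · subst ih
        exact Nat.lt_succ_self _
      · exact lt_trans ih (Nat.lt_succ_self _)

/-- The face poset: `χ(X)` with the partial order generated by the faces of codimension one. -/
instance instPartialOrder : PartialOrder X.FacePoset where
  le := Relation.ReflTransGen FaceStep
  le_refl _ := Relation.ReflTransGen.refl
  le_trans _ _ _ h₁ h₂ := h₁.trans h₂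
  le_antisymm _ _ h₁ h₂ := by
    rcases dim_le_or_eq h₁ with h | h
    · exact h
    · rcases dim_le_or_eq h₂ with h' | h'
      · exact h'.symm
      · exact absurd h' h.asymm

theorem verts_subset_of_le {σ τ : X.FacePoset} (h : σ ≤ τ) : σ.verts ⊆ τ.verts := by
  have h' : Relation.ReflTransGen FaceStep σ τ := h
  clear h
  induction h' with
  | refl => exact Finset.Subset.refl _
  | tail _ hs ih =>
    refine ih.trans ?_
    cases hs with
    | mk τ v h =>
      intro w hw
      have hw' : w ∈ (X.V (X.d v τ h) : Set (X.S 0)) := hw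
      rw [X.V_d] at hw'
      exact hw'.1

/-- A vertex `v` is a face of `σ` if and only if it belongs to the set of vertices of `σ`. -/
theorem ofVertex_le_iff (v : X.S 0) (σ : X.FacePoset) : ofVertex v ≤ σ ↔ v ∈ σ.verts := by
  constructor
  · intro h
    refine verts_subset_of_le h ?_
    change v ∈ X.V v
    rw [X.V_vertex]
    exact Finset.mem_singleton_self v
  · obtain ⟨n, σ⟩ := σ
    change v ∈ X.V σ → _
    induction n with
    | zero =>
      intro h
      rw [X.V_vertex, Finset.mem_singleton] at h
      subst h
      exact le_refl _
    | succ n ih =>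
      intro h
      have hc : 1 < (X.V σ).card := by rw [X.card_V]; omega
      obtain ⟨w, hw, hne⟩ := Finset.exists_mem_ne hc v
      have hv : v ∈ X.V (X.d w σ hw) := by
        rw [← Finset.mem_coe, X.V_d]
        exact ⟨h, fun e => hne e.symm⟩
      exact Relation.ReflTransGen.tail (ih (X.d w σ hw) hv) (FaceStep.mk σ w hw)

end FacePoset

open FacePoset in
/-- The vertex `v` is dominated by the other vertex `v'`: every simplex `σ` with `v ⪯ σ` has a
unique coface `τ` with `V(τ) = V(σ) ∪ {v'}`. -/
def IsDominatedBy (X : DeltaComplex.{u}) (v v' : X.S 0) : Prop :=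
  v' ≠ v ∧ ∀ σ : X.FacePoset, ofVertex v ≤ σ →
    ∃! τ : X.FacePoset,
      (τ.verts : Set (X.S 0)) = (σ.verts : Set (X.S 0)) ∪ {v'} ∧ σ ≤ τ

/-- The vertex `v` is dominated by some other vertex. -/
def IsDominated (X : DeltaComplex.{u}) (v : X.S 0) : Prop :=
  ∃ v' : X.S 0, X.IsDominatedBy v v'

theorem notMem_V_of_mem (X : DeltaComplex.{u}) {v w : X.S 0} {n : ℕ} {σ : X.S n}
    (hσ : v ∉ X.V σ) (hw : w ∈ X.V σ) : v ∉ X.V w := by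
  rw [X.V_vertex, Finset.mem_singleton]
  rintro rfl
  exact hσ hw

theorem notMem_V_d (X : DeltaComplex.{u}) {v w : X.S 0} {n : ℕ} {σ : X.S (n + 1)}
    (hσ : v ∉ X.V σ) (hw : w ∈ X.V σ) : v ∉ X.V (X.d w σ hw) := by
  rw [← Finset.mem_coe, X.V_d]
  exact fun h => hσ h.1

/-- The vertices of a simplex not containing `v`, as vertices different from `v`. -/
def deleteV (X : DeltaComplex.{u}) (v : X.S 0) {n : ℕ} (σ : {σ : X.S n // v ∉ X.V σ}) :
    Finset {w : X.S 0 // v ∉ X.V w} :=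
  (X.V σ.1).attach.map
    ⟨fun w => ⟨w.1, X.notMem_V_of_mem σ.2 w.2⟩,
      fun _ _ h => Subtype.ext (congrArg (fun z => z.1) h)⟩

theorem mem_deleteV (X : DeltaComplex.{u}) {v : X.S 0} {n : ℕ} {σ : {σ : X.S n // v ∉ X.V σ}}
    {w : {w : X.S 0 // v ∉ X.V w}} : w ∈ X.deleteV v σ ↔ w.1 ∈ X.V σ.1 := by
  simp only [deleteV, Finset.mem_map, Finset.mem_attach, true_and, Subtype.exists]
  constructor
  · rintro ⟨a, ha, rfl⟩
    exact ha
  · intro h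
    exact ⟨w.1, h, rfl⟩

/-- The subcomplex `X \ v`, obtained by deleting all simplices that contain the vertex `v`; the
vertex sets and the faces are those of `X`. -/
def delete (X : DeltaComplex.{u}) (v : X.S 0) : DeltaComplex.{u} where
  S n := {σ : X.S n // v ∉ X.V σ}
  V σ := X.deleteV v σ
  d w σ h := ⟨X.d w.1 σ.1 (X.mem_deleteV.1 h), X.notMem_V_d σ.2 (X.mem_deleteV.1 h)⟩
  card_V σ := by
    rw [deleteV, Finset.card_map, Finset.card_attach, X.card_V]
  V_vertex w := by
    ext z
    rw [mem_deleteV, X.V_vertex, Finset.mem_singleton, Finset.mem_singleton, Subtype.ext_iff]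
  V_d w σ h := by
    ext z
    rw [Finset.mem_coe, mem_deleteV, ← Finset.mem_coe, X.V_d, Set.mem_sdiff, Set.mem_sdiff,
      Finset.mem_coe, Finset.mem_coe, mem_deleteV, Set.mem_singleton_iff, Set.mem_singleton_iff,
      Subtype.ext_iff]
  d_comm w z σ hw hz hzw hwz :=
    Subtype.ext (X.d_comm w.1 z.1 σ.1 (X.mem_deleteV.1 hw) (X.mem_deleteV.1 hz)
      (X.mem_deleteV.1 hzw) (X.mem_deleteV.1 hwz))

/-- The elementary strong collapses from `X` to `X \ v`, for a dominated vertex `v` of `X`. -/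
inductive ElementaryStrongCollapse : DeltaComplex.{u} → DeltaComplex.{u} → Prop
  | mk (X : DeltaComplex.{u}) (v : X.S 0) (h : X.IsDominated v) :
      ElementaryStrongCollapse X (X.delete v)

/-- There is a finite sequence of elementary strong collapses from `X` to `Y`. -/
def StrongCollapse : DeltaComplex.{u} → DeltaComplex.{u} → Prop :=
  Relation.ReflTransGen ElementaryStrongCollapse

/-- `X` consists of a single vertex (and no other simplices). -/
def IsPoint (X : DeltaComplex.{u}) : Prop :=
  ∃ v : X.S 0, ∀ σ : X.FacePoset, σ = FacePoset.ofVertex v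

/-- `X` collapses strongly to a single vertex. -/
def StronglyCollapsible (X : DeltaComplex.{u}) : Prop :=
  ∃ Y : DeltaComplex.{u}, X.StrongCollapse Y ∧ Y.IsPoint

end DeltaComplex

namespace BeatPoint

/-- Down beat points: the elements strictly below `x` have a greatest element. -/
def IsDownBeatPoint {P : Type u} [PartialOrder P] (x : P) : Prop :=
  ∃ y : P, IsGreatest (Set.Iio x) y

/-- Up beat points: the elements strictly above `x` have a least element. -/
def IsUpBeatPoint {P : Type u} [PartialOrder P] (x : P) : Prop :=
  ∃ y : P, IsLeast (Set.Ioi x) y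

/-- A beat point is a down beat point or an up beat point. -/
def IsBeatPoint {P : Type u} [PartialOrder P] (x : P) : Prop :=
  IsDownBeatPoint x ∨ IsUpBeatPoint x

/-- The elementary strong collapses between subposets of `P` (with the induced order): from `A`
to `A \ {x}`, for a beat point `x` of the poset `A`. -/
inductive ElementaryStrongCollapse {P : Type u} [PartialOrder P] : Set P → Set P → Prop
  | mk (A : Set P) (x : A) (h : IsBeatPoint x) : ElementaryStrongCollapse A (A \ {x.1})

/-- There is a finite sequence of elementary strong collapses from the subposet `A` of `P` to
the subposet `B`. -/
def StrongCollapse {P : Type u} [PartialOrder P] : Set P → Set P → Prop :=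
  Relation.ReflTransGen ElementaryStrongCollapse

/-- The poset `P` collapses strongly to a single point. -/
def StronglyCollapsible (P : Type u) [PartialOrder P] : Prop :=
  ∃ x : P, StrongCollapse (Set.univ : Set P) {x}

end BeatPoint

/-! Both conditions are equivalent to `OrderContractible` of the face poset: the identity is joined
to a constant map by a chain of comparable monotone maps.

Each elementary collapse, of posets or of complexes, is a retraction joined to the identity by such
a fence, so contractibility passes both ways (`iff_of_retract`). Conversely, collapse as long as
possible. A finite poset without beat points has its identity comparable to no other endomorphism,
so contractibility makes it a point. A complex without dominated vertices may still have beat points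
in its face poset (free faces), so the identity need not be isolated there. Instead, the larger
class `FixesVertices` is closed under comparability; it then contains a constant map, which leaves
only one vertex. -/

/-! ### Contractibility and fences -/

/-- A poset is contractible if its identity is joined to a constant map by a fence of
order-preserving maps. -/
def OrderContractible (P : Type u) [PartialOrder P] : Prop :=
  ∃ c : P, Relation.EqvGen (· ≤ ·) (OrderHom.id : P →o P) (OrderHom.const P c)

theorem eqvGen_le_map {α β : Type*} [Preorder α] [Preorder β] {F : α → β} (hF : Monotone F)
    {a b : α} (h : Relation.EqvGen (· ≤ ·) a b) : Relation.EqvGen (· ≤ ·) (F a) (F b) := by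
  induction h with
  | rel _ _ h => exact .rel _ _ (hF h)
  | refl _ => exact .refl _
  | symm _ _ _ ih => exact .symm _ _ ih
  | trans _ _ _ _ _ ih₁ ih₂ => exact .trans _ _ _ ih₁ ih₂

/-- Invariance principle for fences: applied to a property of monotone maps, it carries information
from the identity to a constant map. -/
theorem eqvGen_le_iff {α : Type*} [Preorder α] {p : α → Prop}
    (hup : ∀ a b, a ≤ b → p a → p b) (hdown : ∀ a b, a ≤ b → p b → p a)
    {a b : α} (h : Relation.EqvGen (· ≤ ·) a b) : p a ↔ p b := by
  induction h with
  | rel _ _ h => exact ⟨hup _ _ h, hdown _ _ h⟩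
  | refl _ => exact Iff.rfl
  | symm _ _ _ ih => exact ih.symm
  | trans _ _ _ _ _ ih₁ ih₂ => exact ih₁.trans ih₂

namespace OrderContractible

theorem of_subsingleton {P : Type u} [PartialOrder P] [Subsingleton P] (c : P) :
    OrderContractible P := by
  refine ⟨c, ?_⟩
  have h : (OrderHom.id : P →o P) = OrderHom.const P c :=
    OrderHom.ext _ _ (funext fun _ => Subsingleton.elim _ _)
  rw [h]
  exact .refl _

/-- Contractibility passes to, and lifts from, a deformation retract. -/
theorem iff_of_retract {P Q : Type u} [PartialOrder P] [PartialOrder Q] (i : Q ↪o P)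
    (g : P →o P) (hg : ∀ p, ∃ q, i q = g p) (hgi : ∀ q, g (i q) = i q)
    (hid : Relation.EqvGen (· ≤ ·) (OrderHom.id : P →o P) g) :
    OrderContractible P ↔ OrderContractible Q := by
  choose r₀ hr using hg
  let r : P →o Q := ⟨r₀, fun a b hab => by
    rw [← i.le_iff_le, hr, hr]
    exact g.monotone hab⟩
  have hir : ∀ p, i (r p) = g p := hr
  have hri : ∀ q, r (i q) = q := fun q => i.injective (by rw [hir, hgi])
  let j : Q →o P := ⟨i, i.monotone⟩
  constructor
  · rintro ⟨c, hc⟩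
    refine ⟨r c, ?_⟩
    have h := eqvGen_le_map (F := fun f : P →o P => (r.comp f).comp j)
      (fun f f' (hf : ∀ p, f p ≤ f' p) q => r.monotone (hf (j q))) hc
    convert h using 1
    · ext q
      exact (hri q).symm
    · rfl
  · rintro ⟨c, hc⟩
    refine ⟨i c, hid.trans _ _ _ ?_⟩
    have h := eqvGen_le_map (F := fun f : Q →o Q => (j.comp f).comp r)
      (fun f f' (hf : ∀ q, f q ≤ f' q) p => j.monotone (hf (r p))) hc
    convert h using 1
    · ext p
      exact (hir p).symm
    · rfl

theorem univ_iff {P : Type u} [PartialOrder P] :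
    OrderContractible P ↔ OrderContractible (Set.univ : Set P) :=
  iff_of_retract (OrderEmbedding.subtype _) OrderHom.id (fun p => ⟨⟨p, trivial⟩, rfl⟩)
    (fun _ => rfl) (.refl _)

end OrderContractible

/-! ### Beat points of finite posets -/

namespace BeatPoint

theorem orderContractible_diff_singleton_iff {P : Type u} [PartialOrder P] {A : Set P} {x : A}
    (h : IsBeatPoint x) :
    OrderContractible A ↔ OrderContractible (A \ {x.1} : Set P) := by
  classical
  -- These properties of `y` hold for both kinds of beat point, and they are what makes the map
  -- moving only `x` to `y` monotone and comparable to the identity.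
  obtain ⟨y, hyx, hlt, hgt, hcomp⟩ : ∃ y : A, y ≠ x ∧ (∀ a, a < x → a ≤ y) ∧
      (∀ a, x < a → y ≤ a) ∧ (y ≤ x ∨ x ≤ y) := by
    rcases h with ⟨y, hy, hmax⟩ | ⟨y, hy, hmin⟩
    · exact ⟨y, ne_of_lt hy, fun a ha => hmax ha, fun a ha => (lt_trans hy ha).le,
        Or.inl (le_of_lt hy)⟩
    · exact ⟨y, ne_of_gt hy, fun a ha => (lt_trans ha hy).le, fun a ha => hmin ha,
        Or.inr (le_of_lt hy)⟩
  let i : (A \ {x.1} : Set P) ↪o A :=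
    OrderEmbedding.ofMapLEIff (fun a => ⟨a.1, a.2.1⟩) (fun _ _ => Iff.rfl)
  let g : A →o A := ⟨fun a => if a = x then y else a, fun a b hab => by
    dsimp only
    split_ifs with ha hb hb
    · exact le_rfl
    · subst ha
      exact hgt b (lt_of_le_of_ne hab (Ne.symm hb))
    · subst hb
      exact hlt a (lt_of_le_of_ne hab ha)
    · exact hab⟩
  have hgx : g x = y := if_pos rfl
  have hgn : ∀ a, a ≠ x → g a = a := fun a ha => if_neg ha
  refine OrderContractible.iff_of_retract i g (fun a => ?_) (fun q => ?_) ?_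
  · have hne : g a ≠ x := by
      by_cases ha : a = x
      · rwa [ha, hgx]
      · rwa [hgn a ha]
    exact ⟨⟨(g a).1, (g a).2, fun e => hne (Subtype.ext e)⟩, rfl⟩
  · exact hgn _ fun e => q.2.2 (congrArg Subtype.val e)
  · rcases hcomp with hc | hc
    · refine .symm _ _ (.rel _ _ fun a => ?_)
      by_cases ha : a = x
      · subst ha
        exact hgx.trans_le hc
      · exact (hgn a ha).le
    · refine .rel _ _ fun a => ?_
      by_cases ha : a = x
      · subst ha
        exact hc.trans_eq hgx.symm
      · exact (hgn a ha).ge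

theorem StrongCollapse.orderContractible_iff {P : Type u} [PartialOrder P] {A B : Set P}
    (h : StrongCollapse A B) : OrderContractible A ↔ OrderContractible B := by
  have h' : Relation.ReflTransGen ElementaryStrongCollapse A B := h
  clear h
  induction h' with
  | refl => exact Iff.rfl
  | tail _ hs ih =>
    cases hs with
    | mk x hx => exact ih.trans (orderContractible_diff_singleton_iff hx)

/-- Descending induction: if `f` fixes everything above `x` but moves `x`, then `f x` is least above
`x`, an up beat point. -/
theorem eq_id_of_id_le {P : Type u} [PartialOrder P] [Finite P] (h : ∀ x : P, ¬IsBeatPoint x)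
    {f : P →o P} (hf : OrderHom.id ≤ f) : f = OrderHom.id := by
  ext x
  change f x = x
  induction x using WellFoundedGT.induction with
  | ind x ih =>
    by_contra hne
    refine h x (Or.inr ⟨f x, lt_of_le_of_ne (hf x) (Ne.symm hne), fun y hy => ?_⟩)
    rw [← ih y hy]
    exact f.monotone (le_of_lt hy)

theorem eq_id_of_le_id {P : Type u} [PartialOrder P] [Finite P] (h : ∀ x : P, ¬IsBeatPoint x)
    {f : P →o P} (hf : f ≤ OrderHom.id) : f = OrderHom.id := by
  ext x
  change f x = x
  induction x using WellFoundedLT.induction with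
  | ind x ih =>
    by_contra hne
    refine h x (Or.inl ⟨f x, lt_of_le_of_ne (hf x) hne, fun y hy => ?_⟩)
    rw [← ih y hy]
    exact f.monotone (le_of_lt hy)

theorem exists_strongCollapse_singleton {P : Type u} [PartialOrder P] [Finite P] (A : Set P)
    (hA : OrderContractible A) : ∃ x, StrongCollapse A {x} := by
  induction A using WellFoundedLT.induction with
  | ind A ih =>
    by_cases h : ∃ x : A, IsBeatPoint x
    · obtain ⟨x, hx⟩ := h
      have hlt : A \ {x.1} < A :=
        Set.ssubset_iff_subset_ne.2 ⟨Set.sdiff_subset, fun e =>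
          ((Set.ext_iff.1 e x.1).2 x.2).2 rfl⟩
      obtain ⟨z, hz⟩ := ih _ hlt ((orderContractible_diff_singleton_iff hx).1 hA)
      exact ⟨z, Relation.ReflTransGen.head (.mk A x hx) hz⟩
    · push Not at h
      obtain ⟨c, hc⟩ := hA
      have hid := (eqvGen_le_iff (p := fun f : A →o A => f = OrderHom.id)
        (fun f g hfg hf => eq_id_of_id_le h (hf ▸ hfg))
        (fun f g hfg hg => eq_id_of_le_id h (hg ▸ hfg)) hc).1 rfl
      have hA : A = {c.1} := by
        ext a
        refine ⟨fun ha => ?_, fun ha => ha ▸ c.2⟩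
        exact (congrArg Subtype.val (DFunLike.congr_fun hid ⟨a, ha⟩)).symm
      exact ⟨c, hA ▸ Relation.ReflTransGen.refl⟩

/-- A finite poset is strongly collapsible if and only if it is contractible. -/
theorem stronglyCollapsible_iff_orderContractible {P : Type u} [PartialOrder P] [Finite P] :
    StronglyCollapsible P ↔ OrderContractible P := by
  rw [OrderContractible.univ_iff]
  refine ⟨?_, exists_strongCollapse_singleton _⟩
  rintro ⟨x, hx⟩
  exact hx.orderContractible_iff.2 (OrderContractible.of_subsingleton ⟨x, rfl⟩)

end BeatPoint

/-! ### Faces of a single simplex -/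

namespace DeltaComplex

namespace FacePoset

variable {X : DeltaComplex.{u}}

/-- An `n`-simplex, as an element of `χ(X)`. -/
abbrev ofSimplex {n : ℕ} (σ : X.S n) : X.FacePoset := ⟨n, σ⟩

theorem card_verts (σ : X.FacePoset) : σ.verts.card = σ.dim + 1 := X.card_V σ.2

theorem verts_nonempty (σ : X.FacePoset) : σ.verts.Nonempty := by
  rw [← Finset.card_pos, card_verts]
  exact Nat.succ_pos _

theorem verts_ofVertex (v : X.S 0) : (ofVertex v).verts = {v} := X.V_vertex v

theorem mem_V_d {n : ℕ} {v w : X.S 0} {σ : X.S (n + 1)} (h : v ∈ X.V σ) :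
    w ∈ X.V (X.d v σ h) ↔ w ∈ X.V σ ∧ w ≠ v := by
  rw [← Finset.mem_coe, X.V_d]
  rfl

theorem d_le {n : ℕ} {v : X.S 0} {σ : X.S (n + 1)} (h : v ∈ X.V σ) :
    ofSimplex (X.d v σ h) ≤ ofSimplex σ :=
  Relation.ReflTransGen.single (.mk σ v h)

/-- If the last step of a chain from `ρ` to `σ` deletes another vertex `w`, induction removes `v`
one level lower, and `d_comm` exchanges the two deletions. -/
theorem le_d {n : ℕ} {ρ : X.FacePoset} {v : X.S 0} {σ : X.S (n + 1)} (h : v ∈ X.V σ)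
    (hρ : ρ ≤ ofSimplex σ) (hv : v ∉ ρ.verts) : ρ ≤ ofSimplex (X.d v σ h) := by
  induction n with
  | zero =>
    rcases Relation.ReflTransGen.cases_tail hρ with e | ⟨π, hπ, hs⟩
    · subst e
      exact absurd h hv
    · cases hs with
      | mk _ w hw =>
        by_cases hwv : w = v
        · subst hwv
          exact hπ
        · obtain ⟨z, hz⟩ := ρ.verts_nonempty
          have hzd : z ∈ X.V (X.d w σ hw) := verts_subset_of_le hπ hz
          have hvd : v ∈ X.V (X.d w σ hw) := (mem_V_d hw).2 ⟨h, Ne.symm hwv⟩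
          have hzv : z = v := Finset.card_le_one.1 (X.card_V (X.d w σ hw)).le z hzd v hvd
          exact absurd (hzv ▸ hz) hv
  | succ n ih =>
    rcases Relation.ReflTransGen.cases_tail hρ with e | ⟨π, hπ, hs⟩
    · subst e
      exact absurd h hv
    · cases hs with
      | mk _ w hw =>
        by_cases hwv : w = v
        · subst hwv
          exact hπ
        · have hvd : v ∈ X.V (X.d w σ hw) := (mem_V_d hw).2 ⟨h, Ne.symm hwv⟩
          have hwd : w ∈ X.V (X.d v σ h) := (mem_V_d h).2 ⟨hw, hwv⟩
          have hle := ih hvd hπ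
          rw [X.d_comm w v σ hw h hvd hwd] at hle
          exact hle.trans (d_le hwd)

/-- The common coface `σ` is essential, since distinct simplices may share a vertex set. Vertices of
`σ` outside `ρ₂` are deleted until `σ` becomes `ρ₂`. -/
theorem le_of_verts_subset {ρ₁ ρ₂ σ : X.FacePoset} (h₁ : ρ₁ ≤ σ) (h₂ : ρ₂ ≤ σ)
    (h : ρ₁.verts ⊆ ρ₂.verts) : ρ₁ ≤ ρ₂ := by
  obtain ⟨n, σ⟩ := σ
  induction n with
  | zero =>
    rcases dim_le_or_eq h₂ with e | e
    · exact e ▸ h₁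
    · exact absurd e (Nat.not_lt_zero _)
  | succ n ih =>
    rcases dim_le_or_eq h₂ with e | e
    · exact e ▸ h₁
    · have hc : ρ₂.verts.card < (X.V σ).card := by
        rw [card_verts, X.card_V]
        exact Nat.succ_lt_succ e
      obtain ⟨v, hv, hv₂⟩ := Finset.exists_mem_notMem_of_card_lt_card hc
      exact ih (X.d v σ hv) (le_d hv h₁ fun hv₁ => hv₂ (h hv₁)) (le_d hv h₂ hv₂)

theorem eq_of_verts_eq {ρ₁ ρ₂ σ : X.FacePoset} (h₁ : ρ₁ ≤ σ) (h₂ : ρ₂ ≤ σ)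
    (h : ρ₁.verts = ρ₂.verts) : ρ₁ = ρ₂ :=
  le_antisymm (le_of_verts_subset h₁ h₂ h.subset) (le_of_verts_subset h₂ h₁ h.superset)

theorem exists_le_verts_eq (σ : X.FacePoset) {s : Finset (X.S 0)} (hs : s.Nonempty)
    (h : s ⊆ σ.verts) : ∃ ρ ≤ σ, ρ.verts = s := by
  by_cases e : s = σ.verts
  · exact ⟨_, le_rfl, e.symm⟩
  obtain ⟨n, σ⟩ := σ
  induction n with
  | zero =>
    exact absurd (Finset.eq_of_subset_of_card_le h ((X.card_V σ).trans_le hs.card_pos)) e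
  | succ n ih =>
    obtain ⟨v, hv, hvs⟩ := Finset.exists_of_ssubset (Finset.ssubset_iff_subset_ne.2 ⟨h, e⟩)
    have hsub : s ⊆ X.V (X.d v σ hv) := fun w hw =>
      (mem_V_d hv).2 ⟨h hw, fun e => hvs (e ▸ hw)⟩
    by_cases e' : s = X.V (X.d v σ hv)
    · exact ⟨_, d_le hv, e'.symm⟩
    · obtain ⟨ρ, hρ, hρs⟩ := ih (X.d v σ hv) hsub e'
      exact ⟨ρ, hρ.trans (d_le hv), hρs⟩

end FacePoset

/-! ### Deleting a dominated vertex -/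

open FacePoset

variable {X : DeltaComplex.{u}}

/-- The simplices of `X \ v`, as simplices of `X`. -/
def deleteInclusion (v : X.S 0) (σ : (X.delete v).FacePoset) : X.FacePoset := ⟨σ.1, σ.2.1⟩

theorem deleteInclusion_injective (v : X.S 0) : Function.Injective (deleteInclusion v) := by
  rintro ⟨n, σ, hσ⟩ ⟨m, τ, hτ⟩ h
  cases h
  rfl

theorem exists_deleteInclusion_eq_iff {v : X.S 0} {σ : X.FacePoset} :
    (∃ τ, deleteInclusion v τ = σ) ↔ v ∉ σ.verts := by
  constructor
  · rintro ⟨τ, rfl⟩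
    exact τ.2.2
  · exact fun h => ⟨⟨σ.1, σ.2, h⟩, rfl⟩

/-- Every face of a simplex avoiding `v` avoids `v`, so a chain of faces in `X` ending in `X \ v`
lies there entirely. -/
theorem deleteInclusion_le_iff {v : X.S 0} {σ τ : (X.delete v).FacePoset} :
    deleteInclusion v σ ≤ deleteInclusion v τ ↔ σ ≤ τ := by
  constructor
  · intro h
    obtain ⟨τ', hτ'⟩ : ∃ τ', deleteInclusion v τ = τ' := ⟨_, rfl⟩
    rw [hτ'] at h
    have h' : Relation.ReflTransGen FaceStep (deleteInclusion v σ) τ' := h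
    clear h
    induction h' generalizing τ with
    | refl => exact (deleteInclusion_injective v hτ').ge
    | tail _ hs ih =>
      cases hs with
      | mk ρ w hw =>
        obtain ⟨m, τ, hτ⟩ := τ
        cases hτ'
        exact (ih (τ := ⟨_, X.d w τ hw, X.notMem_V_d hτ hw⟩) rfl).trans
          (d_le (X := X.delete v) (σ := ⟨τ, hτ⟩) (v := ⟨w, X.notMem_V_of_mem hτ hw⟩)
            (X.mem_deleteV.2 hw))
  · intro h
    have h' : Relation.ReflTransGen FaceStep σ τ := h
    clear h
    induction h' with
    | refl => exact le_rfl
    | tail _ hs ih =>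
      cases hs with
      | mk τ w hw => exact ih.trans (d_le (X.mem_deleteV.1 hw))

/-- Deleting a dominated vertex does not change whether the face poset is contractible. -/
theorem orderContractible_delete_iff {v : X.S 0} (h : X.IsDominated v) :
    OrderContractible X.FacePoset ↔ OrderContractible (X.delete v).FacePoset := by
  classical
  obtain ⟨v', hne, hdom⟩ := h
  -- `f` adds `v'` to the simplices containing `v`, and `g` below then removes `v`. The fence is `id
  -- ≤ f ≥ g`, with `g` a retraction onto `X \ v`.
  have hf : ∀ σ : X.FacePoset, ∃ τ : X.FacePoset, σ ≤ τ ∧ (v ∉ σ.verts → τ = σ) ∧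
      (v ∈ σ.verts → τ.verts = insert v' σ.verts ∧
        ∀ τ', σ ≤ τ' → τ'.verts = insert v' σ.verts → τ' = τ) := by
    intro σ
    by_cases hv : v ∈ σ.verts
    · obtain ⟨τ, ⟨hτ, hle⟩, huniq⟩ := hdom σ ((ofVertex_le_iff v σ).2 hv)
      refine ⟨τ, hle, fun h => absurd hv h, fun _ => ⟨?_, fun τ' hle' hτ' => huniq _ ⟨?_, hle'⟩⟩⟩
      · rw [← Finset.coe_inj, hτ, Finset.coe_insert, Set.union_singleton]
      · rw [hτ', Finset.coe_insert, Set.union_singleton]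
    · exact ⟨σ, le_rfl, fun _ => rfl, fun h => absurd h hv⟩
  choose f hle hf_not hf_mem using hf
  have hmono : Monotone f := by
    intro σ τ hστ
    by_cases hv : v ∈ σ.verts
    · have hvτ := verts_subset_of_le hστ hv
      -- The face of `f τ` on the vertices of `f σ` is a coface of `σ`, so uniqueness identifies it
      -- with `f σ`.
      obtain ⟨ρ, hρ, hρv⟩ := exists_le_verts_eq (f τ) (s := insert v' σ.verts)
        (Finset.insert_nonempty _ _) (by
          rw [(hf_mem τ hvτ).1]
          exact Finset.insert_subset_insert _ (verts_subset_of_le hστ))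
      rw [← (hf_mem σ hv).2 ρ (le_of_verts_subset (hστ.trans (hle τ)) hρ
        (hρv ▸ Finset.subset_insert _ _)) hρv]
      exact hρ
    · rw [hf_not σ hv]
      exact hστ.trans (hle τ)
  have hg : ∀ σ, ∃ ρ ≤ f σ, ρ.verts = (f σ).verts.erase v := by
    intro σ
    refine exists_le_verts_eq _ ?_ (Finset.erase_subset _ _)
    by_cases hv : v ∈ σ.verts
    · refine ⟨v', Finset.mem_erase.2 ⟨hne, ?_⟩⟩
      rw [(hf_mem σ hv).1]
      exact Finset.mem_insert_self _ _
    · rw [hf_not σ hv, Finset.erase_eq_of_notMem hv]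
      exact σ.verts_nonempty
  choose g hgle hgv using hg
  refine OrderContractible.iff_of_retract
    (OrderEmbedding.ofMapLEIff (deleteInclusion v) fun _ _ => deleteInclusion_le_iff)
    ⟨g, fun σ τ hστ => le_of_verts_subset ((hgle σ).trans (hmono hστ)) (hgle τ) ?_⟩
    (fun σ => ?_) (fun σ => ?_)
    (.trans _ ⟨f, hmono⟩ _ (.rel _ _ hle) (.symm _ _ (.rel _ _ hgle)))
  · rw [hgv, hgv]
    exact Finset.erase_subset_erase _ (verts_subset_of_le (hmono hστ))
  · refine exists_deleteInclusion_eq_iff.2 ?_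
    change v ∉ (g σ).verts
    rw [hgv]
    exact Finset.notMem_erase _ _
  · have hv : v ∉ (deleteInclusion v σ).verts := σ.2.2
    change g (deleteInclusion v σ) = deleteInclusion v σ
    have hfσ := hf_not _ hv
    refine eq_of_verts_eq (hgle _) hfσ.ge ?_
    rw [hgv, hfσ, Finset.erase_eq_of_notMem hv]

/-! ### Complexes without dominated vertices -/

/-- An order-preserving map of the face poset that fixes the vertices and sends each simplex to
one of its cofaces. -/
def FixesVertices (f : X.FacePoset →o X.FacePoset) : Prop :=
  (∀ v, f (ofVertex v) = ofVertex v) ∧ ∀ σ, σ ≤ f σ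

theorem eq_ofVertex_of_verts_subset {σ : X.FacePoset} {v : X.S 0} (h : σ.verts ⊆ {v}) :
    σ = ofVertex v := by
  have hσ : σ.verts = {v} := (Finset.Nonempty.subset_singleton_iff σ.verts_nonempty).1 h
  exact eq_of_verts_eq le_rfl ((ofVertex_le_iff v σ).2 (hσ ▸ Finset.mem_singleton_self v))
    (hσ.trans (verts_ofVertex v).symm)

/-- `σ` and `f σ` are both faces of `g σ`, and `f σ` contains every vertex of `σ` because `f` fixes
it. -/
theorem FixesVertices.of_le {f g : X.FacePoset →o X.FacePoset} (hg : FixesVertices g)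
    (hfg : f ≤ g) : FixesVertices f := by
  have hv : ∀ v, f (ofVertex v) = ofVertex v := fun v => by
    refine eq_ofVertex_of_verts_subset ?_
    have h := verts_subset_of_le (hfg (ofVertex v))
    rwa [hg.1, verts_ofVertex] at h
  refine ⟨hv, fun σ => le_of_verts_subset (hg.2 σ) (hfg σ) fun v hvσ => ?_⟩
  rw [← ofVertex_le_iff, ← hv]
  exact f.monotone ((ofVertex_le_iff v σ).2 hvσ)

/-- A vertex `w ≠ v` of `g v` would dominate `v`: for `σ` containing `v`, the simplex `g σ` contains
`σ` and `w`, hence a coface of the required kind. -/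
theorem FixesVertices.of_ge (hX : ∀ v, ¬X.IsDominated v) {f g : X.FacePoset →o X.FacePoset}
    (hf : FixesVertices f) (hfg : f ≤ g) : FixesVertices g := by
  classical
  have hle : ∀ σ, σ ≤ g σ := fun σ => (hf.2 σ).trans (hfg σ)
  refine ⟨fun v => eq_ofVertex_of_verts_subset fun w hw => Finset.mem_singleton.2 ?_, hle⟩
  by_contra hne
  refine hX v ⟨w, hne, fun σ hσ => ?_⟩
  have hsub : insert w σ.verts ⊆ (g σ).verts :=
    Finset.insert_subset (verts_subset_of_le (g.monotone hσ) hw) (verts_subset_of_le (hle σ))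
  obtain ⟨τ, hτ, hτv⟩ := exists_le_verts_eq (g σ) (Finset.insert_nonempty _ _) hsub
  refine ⟨τ, ⟨?_, le_of_verts_subset (hle σ) hτ (hτv ▸ Finset.subset_insert _ _)⟩, ?_⟩
  · rw [hτv, Finset.coe_insert, Set.union_singleton]
  · rintro ρ ⟨hρv, hρ⟩
    -- Uniqueness: `τ ≤ g σ ≤ g ρ` and `ρ ≤ g ρ`, so both are faces of `g ρ`.
    refine eq_of_verts_eq (hle ρ) (hτ.trans (g.monotone hρ)) ?_
    rw [hτv, ← Finset.coe_inj, hρv, Finset.coe_insert, Set.union_singleton]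

/-- A complex without dominated vertices whose face poset is contractible is a point. -/
theorem isPoint_of_orderContractible (hX : ∀ v, ¬X.IsDominated v)
    (h : OrderContractible X.FacePoset) : X.IsPoint := by
  obtain ⟨c, hc⟩ := h
  have hfix : FixesVertices (OrderHom.const X.FacePoset c) :=
    (eqvGen_le_iff (fun _ _ hfg hf => hf.of_ge hX hfg) (fun _ _ hfg hg => hg.of_le hfg) hc).1
      ⟨fun _ => rfl, fun _ => le_rfl⟩
  obtain ⟨v, hv⟩ := c.verts_nonempty
  refine ⟨v, fun σ => eq_ofVertex_of_verts_subset fun w hw => ?_⟩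
  rw [← verts_ofVertex, ← hfix.1 v]
  exact verts_subset_of_le (hfix.2 σ) hw

theorem IsPoint.orderContractible (h : X.IsPoint) : OrderContractible X.FacePoset := by
  obtain ⟨v, hv⟩ := h
  have : Subsingleton X.FacePoset := ⟨fun σ τ => (hv σ).trans (hv τ).symm⟩
  exact OrderContractible.of_subsingleton (ofVertex v)

theorem StrongCollapse.orderContractible_iff {X Y : DeltaComplex.{u}} (h : X.StrongCollapse Y) :
    OrderContractible X.FacePoset ↔ OrderContractible Y.FacePoset := by
  have h' : Relation.ReflTransGen ElementaryStrongCollapse X Y := h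
  clear h
  induction h' with
  | refl => exact Iff.rfl
  | tail _ hs ih =>
    cases hs with
    | mk v hv => exact ih.trans (orderContractible_delete_iff hv)

theorem stronglyCollapsible_of_orderContractible (X : DeltaComplex.{u}) [Finite X.FacePoset]
    (h : OrderContractible X.FacePoset) : X.StronglyCollapsible := by
  induction hn : Nat.card X.FacePoset using Nat.strong_induction_on generalizing X with
  | _ n ih =>
    subst hn
    by_cases hX : ∃ v, X.IsDominated v
    · obtain ⟨v, hv⟩ := hX
      have hfin : Finite (X.delete v).FacePoset :=
        Finite.of_injective _ (deleteInclusion_injective v)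
      have hlt : Nat.card (X.delete v).FacePoset < Nat.card X.FacePoset := by
        refine lt_of_not_ge fun hge => exists_deleteInclusion_eq_iff.1
          (((deleteInclusion_injective v).bijective_of_nat_card_le hge).2 (ofVertex v)) ?_
        rw [verts_ofVertex]
        exact Finset.mem_singleton_self v
      obtain ⟨Y, hY, hp⟩ := ih _ hlt _ ((orderContractible_delete_iff hv).1 h) rfl
      exact ⟨Y, Relation.ReflTransGen.head (.mk X v hv) hY, hp⟩
    · exact ⟨X, Relation.ReflTransGen.refl, isPoint_of_orderContractible (not_exists.1 hX) h⟩

end DeltaComplex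

theorem mainTheorem2 (X : DeltaComplex.{u}) [Finite X.FacePoset] :
    X.StronglyCollapsible ↔ BeatPoint.StronglyCollapsible X.FacePoset := by
  rw [BeatPoint.stronglyCollapsible_iff_orderContractible]
  refine ⟨?_, X.stronglyCollapsible_of_orderContractible⟩
  rintro ⟨Y, hXY, hY⟩
  exact hXY.orderContractible_iff.2 hY.orderContractible
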